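/- Let $\Omega\subset\mathbb C^m$ be a bounded domain, $\Omega^*=\{z:\bar z\in\Omega\}$, and let $\boldsymbol T=(T_1,\dots,T_m)$ be a commuting $m$-tuple of bounded operators on a separable Hilbert space $E$ in the Cowen--Douglas class $B_1(\Omega^*)$: with $D_{\boldsymbol T-w}x=((T_1-w_1)x,\dots,(T_m-w_m)x)$, for every $w\in\Omega^*$ one has $\dim\ker D_{\boldsymbol T-w}=1$ and $\operatorname{ran}D_{\boldsymbol T-w}$ is closed, and the spaces $\ker D_{\boldsymbol T-w}$, $w\in\Omega^*$, span a dense subspace of $E$. For $w\in\Omega$, the curvature matrix of $\boldsymbol T$ at $\bar w$ is $$\mathcal K_{\boldsymbol T}(\bar w)_{i,j}=-\frac{\partial^2}{\partial w_i\,\partial\bar w_j}\log\|\gamma(\bar w)\|^2,\qquad 1\le i,j\le m,$$ where $\gamma$ is any holomorphic frame, on a neighbourhood of $\bar w$ in $\Omega^*$, of the line bundle with fibres $\ker D_{\boldsymbol T-u}$ (it does not depend on the frame). Suppose that $\boldsymbol T$ is realized (up to unitary equivalence) as the adjoint $(M_1^*,\dots,M_m^*)$ of the tuple of multiplication operators by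 the coordinate functions, assumed bounded, on a reproducing kernel Hilbert space $(\mathcal H,K)\subseteq\mathrm{Hol}(\Omega_0)$ for some open subset $\Omega_0\subseteq\Omega$. Regard the Hilbert space tensor product $(\mathcal H,K)\otimes(\mathcal H,K)$ as a space of functions on $\Omega_0\times\Omega_0$, let $\mathcal A_0$ be its subspace of the functions $f$ with $f(z,z)=0$ for all $z\in\Omega_0$, and let $K_{\mathcal A_0}$ be the reproducing kernel of $\mathcal A_0$. Then for every $z\in\Omega_0$ with $K(z,z)\ne0$ the bundle has a holomorphic frame near $\bar z$, the curvature $\mathcal K_{\boldsymbol T}(\bar z)$ is well defined, and for all $1\le i,j\le m$ the following limit exists and $$\mathcal K_{\boldsymbol T}(\bar z)_{i,j}=-\frac{2}{K(z,z)^2}\lim_{\substack{\zeta_i\to z_i\\ \nu_j\to z_j}}\frac{K_{\mathcal A_0}(z,\zeta;z,\nu)}{(z_i-\zeta_i)(\bar z_j-\bar\nu_j)},$$ where $\zeta,\nu\in\Omega_0$ satisfy $\zeta_l=z_l$ for $l\ne i$, $\nu_l=z_l$ for $l\ne j$, $\zeta_i\ne z_i$ and $\nu_j\ne z_j$. In particular,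 for $i=j$ one may take $\nu=\zeta$: $$\mathcal K_{\boldsymbol T}(\bar z)_{i,i}=-\frac{2}{K(z,z)^2}\lim_{\zeta_i\to z_i}\frac{K_{\mathcal A_0}(z,\zeta;z,\zeta)}{|z_i-\zeta_i|^2}\Big|_{\zeta_l=z_l,\ l\ne i}.$$ -/

import Mathlib

open Filter Topology
open scoped TensorProduct ComplexConjugate

noncomputable section

namespace CowenDouglasCurvature

/-! ### The Cowen–Douglas class and its curvature -/

section CowenDouglas

variable {m : ℕ} {E : Type*} [NormedAddCommGroup E] [InnerProductSpace ℂ E]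

/-- `D_{T - w} : E → E ⊕ ⋯ ⊕ E`, `x ↦ ((T₁ - w₁) x, …, (T_m - w_m) x)`. -/
def tupleSub (T : Fin m → E →L[ℂ] E) (w : Fin m → ℂ) : E →L[ℂ] (Fin m → E) :=
  ContinuousLinearMap.pi fun i => T i - w i • ContinuousLinearMap.id ℂ E

/-- The joint eigenspace `ker D_{T - w}`. -/
def jointKer (T : Fin m → E →L[ℂ] E) (w : Fin m → ℂ) : Submodule ℂ E :=
  LinearMap.ker (tupleSub T w).toLinearMap

/-- The commuting tuple `T` belongs to the Cowen–Douglas class `B_n(Ω)`. -/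
structure IsCowenDouglas (n : ℕ) (Ω : Set (Fin m → ℂ)) (T : Fin m → E →L[ℂ] E) : Prop where
  commute : ∀ i j, Commute (T i) (T j)
  rank_ker : ∀ w ∈ Ω, Module.rank ℂ (jointKer T w) = n
  isClosed_range : ∀ w ∈ Ω, IsClosed (Set.range (tupleSub T w))
  dense_span : (⨆ w ∈ Ω, jointKer T w).topologicalClosure = ⊤

/-- `Ω^* = {z : z̄ ∈ Ω}`. -/
def conjSet (Ω : Set (Fin m → ℂ)) : Set (Fin m → ℂ) := {z | star z ∈ Ω}

/-- `γ` is a holomorphic frame, over the open set `U`, of the line bundle with fibre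
`ker D_{T - u}` at `u`. -/
structure IsHolomorphicFrame (T : Fin m → E →L[ℂ] E) (U : Set (Fin m → ℂ))
    (γ : (Fin m → ℂ) → E) : Prop where
  isOpen : IsOpen U
  differentiableOn : DifferentiableOn ℂ γ U
  ne_zero : ∀ u ∈ U, γ u ≠ 0
  span_eq : ∀ u ∈ U, Submodule.span ℂ {γ u} = jointKer T u

/-- The Wirtinger derivative `∂/∂w_i`. -/
def wirtinger (i : Fin m) (f : (Fin m → ℂ) → ℂ) (w : Fin m → ℂ) : ℂ :=
  (fderiv ℝ f w (Pi.single i 1) - Complex.I * fderiv ℝ f w (Pi.single i Complex.I)) / 2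

/-- The Wirtinger derivative `∂/∂w̄_j`. -/
def wirtingerBar (j : Fin m) (f : (Fin m → ℂ) → ℂ) (w : Fin m → ℂ) : ℂ :=
  (fderiv ℝ f w (Pi.single j 1) + Complex.I * fderiv ℝ f w (Pi.single j Complex.I)) / 2

/-- The matrix `-(∂_i ∂̄_j log ‖γ(w̄)‖²)` at the point `w`; the derivatives are taken in the
variable `w`. -/
def frameCurvature (γ : (Fin m → ℂ) → E) (w : Fin m → ℂ) : Matrix (Fin m) (Fin m) ℂ :=
  Matrix.of fun i j =>
    -wirtinger i (wirtingerBar j fun v => ((Real.log (‖γ (star v)‖ ^ 2) : ℝ) : ℂ)) w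

/-- `𝒦` is the curvature matrix `𝒦_T(w̄)` of the tuple `T ∈ B₁(Ω^*)` at `w̄ ∈ Ω^*`: the bundle has
a holomorphic frame near `w̄`, and every such frame computes `𝒦`. -/
def IsCurvatureAt (Ω : Set (Fin m → ℂ)) (T : Fin m → E →L[ℂ] E) (w : Fin m → ℂ)
    (𝒦 : Matrix (Fin m) (Fin m) ℂ) : Prop :=
  (∃ U γ, U ⊆ conjSet Ω ∧ star w ∈ U ∧ IsHolomorphicFrame T U γ) ∧
    ∀ U γ, U ⊆ conjSet Ω → star w ∈ U → IsHolomorphicFrame T U γ → 𝒦 = frameCurvature γ w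

end CowenDouglas

/-! ### Reproducing kernel Hilbert spaces and their tensor products -/

section Kernel

/-- The reproducing kernel of a Hilbert space of scalar functions, as a scalar function
`K(x, y) = K(·, y)(x)`. -/
def scalarKernel {X : Type*} (H : Type*) [NormedAddCommGroup H] [InnerProductSpace ℂ H]
    [RKHS ℂ H X ℂ] [CompleteSpace H] (x y : X) : ℂ :=
  RKHS.kernel H x y 1

variable {X Y : Type*} (H G : Type*)
  [NormedAddCommGroup H] [InnerProductSpace ℂ H] [RKHS ℂ H X ℂ] [CompleteSpace H]
  [NormedAddCommGroup G] [InnerProductSpace ℂ G] [RKHS ℂ G Y ℂ] [CompleteSpace G]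

/-- The Hilbert space tensor product: the completion of the algebraic tensor product. -/
abbrev HilbertTensor (H G : Type*) [NormedAddCommGroup H] [InnerProductSpace ℂ H]
    [NormedAddCommGroup G] [InnerProductSpace ℂ G] : Type _ :=
  UniformSpace.Completion (H ⊗[ℂ] G)

/-- The vector `K_H(·, x) ⊗ K_G(·, y)`. -/
def tensorKerFun (p : X × Y) : HilbertTensor H G :=
  ((RKHS.kerFun H p.1 (1 : ℂ) ⊗ₜ[ℂ] RKHS.kerFun G p.2 (1 : ℂ) : H ⊗[ℂ] G) : HilbertTensor H G)

/-- Evaluation of elements of the tensor product at the points of `X × Y`; it is the continuous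
extension of `(f ⊗ g)(x, y) = f x * g y`. -/
def tensorEval : HilbertTensor H G →L[ℂ] (X × Y → ℂ) :=
  ContinuousLinearMap.pi fun p => innerSL ℂ (tensorKerFun H G p)

theorem tensorEval_tmul (f : H) (g : G) (x : X) (y : Y) :
    tensorEval H G ((f ⊗ₜ[ℂ] g : H ⊗[ℂ] G) : HilbertTensor H G) (x, y) = f x * g y := by
  simp [tensorEval, tensorKerFun]

/-- A continuous functional that kills all kernel functions is zero. -/
theorem clm_eq_zero_of_kerFun (φ : H →L[ℂ] ℂ) (h : ∀ x : X, φ (RKHS.kerFun H x (1 : ℂ)) = 0) :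
    φ = 0 := by
  have hle : Submodule.span ℂ {RKHS.kerFun H x v | (x : X) (v : ℂ)} ≤
      LinearMap.ker φ.toLinearMap := by
    rw [Submodule.span_le]
    rintro _ ⟨x, v, rfl⟩
    have hv : RKHS.kerFun H x v = v • RKHS.kerFun H x (1 : ℂ) := by
      rw [← map_smul]; simp
    simp [hv, h x]
  have htop := Submodule.topologicalClosure_minimal _ hle φ.isClosed_ker
  rw [RKHS.kerFun_dense] at htop
  ext f
  exact htop (Submodule.mem_top (x := f))

theorem tensorEval_injective :
    Function.Injective (tensorEval H G : HilbertTensor H G → X × Y → ℂ) := by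
  refine (injective_iff_map_eq_zero _).mpr fun f hf => ?_
  let B : H →L[ℂ] G →L[ℂ] ℂ :=
    (ContinuousLinearMap.compL ℂ G (H ⊗[ℂ] G) ℂ
      ((innerSL ℂ f).comp UniformSpace.Completion.toComplL)).comp (TensorProduct.mkL ℂ H G)
  have hB : ∀ h g, B h g = inner ℂ f ((h ⊗ₜ[ℂ] g : H ⊗[ℂ] G) : HilbertTensor H G) :=
    fun h g => rfl
  have key : ∀ (x : X) (y : Y), B (RKHS.kerFun H x (1 : ℂ)) (RKHS.kerFun G y (1 : ℂ)) = 0 := by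
    intro x y
    rw [hB, inner_eq_zero_symm]
    exact congrFun hf (x, y)
  have h1 : ∀ x : X, B (RKHS.kerFun H x (1 : ℂ)) = 0 := fun x =>
    clm_eq_zero_of_kerFun G _ (key x)
  have h2 : ∀ h g, B h g = 0 := fun h g => by
    have := clm_eq_zero_of_kerFun H (B.flip g) (fun x => by simp [h1 x])
    simpa using congrArg (fun ψ => ψ h) this
  have h3 : ∀ t : H ⊗[ℂ] G, inner ℂ f (t : HilbertTensor H G) = 0 := by
    intro t
    induction t using TensorProduct.induction_on with
    | zero => rw [UniformSpace.Completion.coe_zero, inner_zero_right]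
    | tmul h g => rw [← hB]; exact h2 h g
    | add a b ha hb => rw [UniformSpace.Completion.coe_add, inner_add_right, ha, hb, add_zero]
  exact UniformSpace.Completion.denseRange_coe.eq_zero_of_inner_left ℂ h3

/-- `(H, K_H) ⊗ (G, K_G)` as a Hilbert space of functions on `X × Y`. -/
instance instRKHSHilbertTensor : RKHS ℂ (HilbertTensor H G) (X × Y) ℂ where
  coeCLM := tensorEval H G
  coeCLM_injective := tensorEval_injective H G

/-- The subspace `𝒜₀` of the functions in `(H, K) ⊗ (H, K)` that vanish on the diagonal. -/
def diagVanishing : Submodule ℂ (HilbertTensor H H) where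
  carrier := {f | ∀ x : X, f (x, x) = 0}
  add_mem' hf hg x := by simp [hf x, hg x]
  zero_mem' x := by simp
  smul_mem' c f hf x := by simp [hf x]

theorem isClosed_diagVanishing : IsClosed (diagVanishing H : Set (HilbertTensor H H)) := by
  have : (diagVanishing H : Set (HilbertTensor H H)) =
      ⋂ x : X, {f : HilbertTensor H H | f (x, x) = 0} := by
    ext f; simp [diagVanishing]
  rw [this]
  exact isClosed_iInter fun x => isClosed_eq (RKHS.continuous_eval (x, x)) continuous_const

instance instCompleteSpaceDiagVanishing : CompleteSpace (diagVanishing H) :=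
  (isClosed_diagVanishing H).completeSpace_coe

/-- `𝒜₀`, with the norm of the tensor product, as a Hilbert space of functions on `X × X`. -/
instance instRKHSDiagVanishing : RKHS ℂ (diagVanishing H) (X × X) ℂ where
  coeCLM := (RKHS.coeCLM ℂ).comp (diagVanishing H).subtypeL
  coeCLM_injective := fun _ _ h => Subtype.ext (RKHS.coeCLM_injective h)

end Kernel

/-! ### Multiplication by the coordinate functions -/

section Multiplication

variable {m : ℕ} {Ω₀ : Set (Fin m → ℂ)} {H : Type*}
  [NormedAddCommGroup H] [InnerProductSpace ℂ H] [RKHS ℂ H Ω₀ ℂ]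

/-- All functions in `H` are holomorphic on `Ω₀`, that is `H ⊆ Hol(Ω₀)`. -/
def ConsistsOfHolomorphic (Ω₀ : Set (Fin m → ℂ)) (H : Type*)
    [NormedAddCommGroup H] [InnerProductSpace ℂ H] [RKHS ℂ H Ω₀ ℂ] : Prop :=
  ∀ f : H, DifferentiableOn ℂ (Function.extend Subtype.val (f : Ω₀ → ℂ) 0) Ω₀

/-- `M` is the tuple of multiplication operators by the coordinate functions. -/
def IsCoordinateMultiplication (M : Fin m → H →L[ℂ] H) : Prop :=
  ∀ (i : Fin m) (f : H) (z : Ω₀), M i f z = (z : Fin m → ℂ) i * f z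

end Multiplication

end CowenDouglasCurvature

end

open CowenDouglasCurvature

noncomputable section

/-! Write `K_x` for the kernel function at `x`, put `a = K_z`, and let `b_i` be the `i`-th partial
derivative at `z̄` of the section `u ↦ K_ū`. This section is holomorphic, and `K_x` is a joint
eigenvector of the `M_i^*` with eigenvalues `x̄_i`. As the joint kernels are lines, the section is a
frame wherever it is nonzero (`isHolomorphicFrame_kernelSection`). By `frameCurvature_apply` the
curvature at `z̄` is minus the polarized Gram determinant `⟨a,a⟩⟨b_i,b_j⟩ - ⟨a,b_j⟩⟨b_i,a⟩` divided
by `‖a‖⁴`.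

The same determinant appears in `𝒜₀`. Let `P` be the orthogonal projection onto `𝒜₀`. Vanishing on
the diagonal means being orthogonal to every `K_x ⊗ K_x`; differentiating in `x` shows that `a ⊗ b_i
+ b_i ⊗ a` is orthogonal to `𝒜₀` as well. Antisymmetric tensors lie in `𝒜₀`, so `P(a ⊗ b_i) = (a ⊗
b_i - b_i ⊗ a)/2`, and the inner products of these vectors are half the determinant: this is the
factor 2 of the theorem.

Finally `K_{𝒜₀}(z,ζ;z,ν) = ⟨P(a ⊗ K_ζ), P(a ⊗ K_ν)⟩`. Since `P(a ⊗ a) = 0`, both `K_ζ` and `K_ν` may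
be replaced by their increments from `K_z`, and the quotient tends to `⟨P(a ⊗ b_i), P(a ⊗ b_j)⟩`. -/

namespace CowenDouglasCurvature

/-! ### Holomorphic maps between normed spaces: Cauchy estimates, weak holomorphy, derivatives -/

section Holomorphic

variable {X G : Type*} [NormedAddCommGroup X] [NormedSpace ℂ X]
  [NormedAddCommGroup G] [NormedSpace ℂ G]

/-- Cauchy's estimate for the first derivative. -/
theorem norm_fderiv_le_of_norm_le {F : X → G} {c : X} {R C : ℝ}
    (hd : DifferentiableOn ℂ F (Metric.ball c R)) (hC : ∀ x ∈ Metric.ball c R, ‖F x‖ ≤ C)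
    (hR : 0 < R) : ‖fderiv ℂ F c‖ ≤ 2 * C / R := by
  refine Complex.norm_fderiv_le_div_of_mapsTo_ball hd (fun x hx => ?_) hR
  rw [Metric.mem_closedBall, dist_eq_norm]
  linarith [norm_sub_le (F x) (F c), hC x hx, hC c (Metric.mem_ball_self hR)]

/-- The first order Taylor remainder of a bounded holomorphic function. -/
theorem norm_taylor_remainder_le {F : X → G} {c w : X} {R C : ℝ}
    (hd : DifferentiableOn ℂ F (Metric.ball c R)) (hC : ∀ x ∈ Metric.ball c R, ‖F x‖ ≤ C)
    (hw : w ∈ Metric.ball c R) :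
    ‖F w - F c - fderiv ℂ F c (w - c)‖ ≤ 4 * C * (‖w - c‖ / R) ^ 2 := by
  have hR : 0 < R := Metric.nonempty_ball.mp ⟨_, hw⟩
  have hc := Metric.mem_ball_self (x := c) hR
  have hC0 : 0 ≤ C := (norm_nonneg _).trans (hC c hc)
  set f : X → G := fun x => F x - F c - fderiv ℂ F c (x - c) with hf
  have hfc : f c = 0 := by simp [hf]
  have hfd : DifferentiableOn ℂ f (Metric.ball c R) :=
    (hd.sub_const _).sub ((fderiv ℂ F c).differentiable.comp
      (differentiable_id.sub_const c)).differentiableOn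
  -- One `2 * C` bounds `F x - F c`, the other bounds the linear term by Cauchy's estimate.
  have hmaps : Set.MapsTo f (Metric.ball c R) (Metric.closedBall (f c) (4 * C)) := by
    intro x hx
    have h1 : ‖fderiv ℂ F c (x - c)‖ ≤ 2 * C := by
      refine ((fderiv ℂ F c).le_of_opNorm_le (norm_fderiv_le_of_norm_le hd hC hR) _).trans ?_
      rw [div_mul_eq_mul_div]
      refine div_le_of_le_mul₀ hR.le (by positivity) ?_
      rw [Metric.mem_ball, dist_eq_norm] at hx
      gcongr
    rw [hfc, mem_closedBall_zero_iff]
    have h2 := norm_sub_le (F x - F c) (fderiv ℂ F c (x - c))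
    linarith [norm_sub_le (F x) (F c), hC x hx, hC c hc]
  -- Vanishing beyond first order lets the higher-order Schwarz lemma give the exponent 2.
  have ho : (f · - f c) =o[𝓝 c] (fun w ↦ ‖w - c‖ ^ 1) := by
    simp only [hfc, sub_zero, pow_one]
    exact (hd.differentiableAt (Metric.ball_mem_nhds _ hR)).hasFDerivAt.isLittleO.norm_right
  have := Complex.dist_le_mul_div_pow_of_mapsTo_ball_of_isLittleO hfd hmaps ho hw
  simpa [hfc, dist_eq_norm, hf] using this

/-- A weakly holomorphic function with values in a Hilbert space is holomorphic. -/
theorem differentiableOn_of_inner [ProperSpace X] {H : Type*} [NormedAddCommGroup H]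
    [InnerProductSpace ℂ H] [CompleteSpace H] {F : X → H} {U : Set X} (hU : IsOpen U)
    (hF : ∀ f : H, DifferentiableOn ℂ (fun u => inner ℂ f (F u)) U) : DifferentiableOn ℂ F U := by
  intro c hc
  obtain ⟨R, hR, hRU⟩ := Metric.nhds_basis_closedBall.mem_iff.mp (hU.mem_nhds hc)
  have hball : Metric.ball c R ⊆ U := Metric.ball_subset_closedBall.trans hRU
  -- Each scalar function is bounded on the compact closed ball, so uniform boundedness makes `F`
  -- norm bounded there.
  obtain ⟨C, hC⟩ : ∃ C, ∀ u : Metric.closedBall c R, ‖innerSL ℂ (F u)‖ ≤ C := by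
    refine banach_steinhaus fun f => ?_
    obtain ⟨C, hC⟩ := (isCompact_closedBall c R).exists_bound_of_continuousOn
      ((hF f).continuousOn.mono hRU)
    refine ⟨C, fun u => ?_⟩
    rw [innerSL_apply_apply, norm_inner_symm]
    exact hC u u.2
  have hCf : ∀ f : H, ∀ u ∈ Metric.ball c R, ‖inner ℂ f (F u)‖ ≤ C * ‖f‖ := fun f u hu => by
    rw [norm_inner_symm]
    exact (innerSL ℂ (F u)).le_of_opNorm_le (hC ⟨u, Metric.ball_subset_closedBall hu⟩) f
  have hd : ∀ f : H, DifferentiableOn ℂ (fun u => inner ℂ f (F u)) (Metric.ball c R) :=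
    fun f => (hF f).mono hball
  have hda : ∀ f : H, DifferentiableAt ℂ (fun u => inner ℂ f (F u)) c :=
    fun f => (hd f).differentiableAt (Metric.ball_mem_nhds _ hR)
  have hC0 : 0 ≤ C := (norm_nonneg _).trans (hC ⟨c, Metric.mem_closedBall_self hR.le⟩)
  have hder : ∀ (f : H) (v : X),
      ‖fderiv ℂ (fun u => inner ℂ f (F u)) c v‖ ≤ 2 * C / R * ‖v‖ * ‖f‖ := fun f v => by
    refine ((fderiv ℂ (fun u => inner ℂ f (F u)) c).le_of_opNorm_le
      (norm_fderiv_le_of_norm_le (hd f) (hCf f) hR) v).trans_eq ?_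
    ring
  -- The candidate derivative comes from Riesz representation; the weak derivative is
  -- conjugate-linear in `f`, so its conjugate is the functional represented.
  have hL : ∀ v : X, ∃ y : H, ∀ f : H,
      inner ℂ f y = fderiv ℂ (fun u => inner ℂ f (F u)) c v := by
    intro v
    let φ : H →ₗ[ℂ] ℂ :=
      { toFun := fun f => conj (fderiv ℂ (fun u => inner ℂ f (F u)) c v)
        map_add' := fun f g => by
          simp only [inner_add_left]
          rw [fderiv_fun_add (hda f) (hda g)]
          simp
        map_smul' := fun a f => by
          simp only [inner_smul_left]
          rw [fderiv_const_mul (hda f)]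
          simp }
    refine ⟨(InnerProductSpace.toDual ℂ H).symm
      (φ.mkContinuous (2 * C / R * ‖v‖) fun f => ?_), fun f => ?_⟩
    · simpa [φ] using hder f v
    · rw [← inner_conj_symm, InnerProductSpace.toDual_symm_apply]
      simp [φ]
  choose L hL using hL
  let Λ : X →ₗ[ℂ] H :=
    { toFun := L
      map_add' := fun v w => ext_inner_left ℂ fun f => by simp [inner_add_right, hL]
      map_smul' := fun a v => ext_inner_left ℂ fun f => by simp [inner_smul_right, hL] }
  have hΛ : ∀ v, ‖Λ v‖ ≤ 2 * C / R * ‖v‖ := fun v => by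
    by_cases h0 : ‖Λ v‖ = 0
    · rw [h0]; positivity
    · have h1 := hder (Λ v) v
      rw [← hL, show L v = Λ v from rfl, inner_self_eq_norm_sq_to_K] at h1
      have h2 : ‖Λ v‖ * ‖Λ v‖ ≤ 2 * C / R * ‖v‖ * ‖Λ v‖ := by
        simpa [sq] using h1
      exact le_of_mul_le_mul_right h2 (lt_of_le_of_ne (norm_nonneg _) (Ne.symm h0))
  -- The scalar remainder bound is linear in `‖f‖`; testing against the remainder vector itself
  -- turns it into a norm bound.
  have hrem : ∀ w ∈ Metric.ball c R,
      ‖F w - F c - Λ.mkContinuous _ hΛ (w - c)‖ ≤ 4 * C * (‖w - c‖ / R) ^ 2 := by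
    intro w hw
    set y := F w - F c - Λ.mkContinuous _ hΛ (w - c) with hy
    by_cases h0 : ‖y‖ = 0
    · rw [h0]; positivity
    · have h1 := norm_taylor_remainder_le (hd y) (hCf y) hw
      rw [← hL, ← inner_sub_right, ← inner_sub_right,
        show F w - F c - L (w - c) = y from rfl, inner_self_eq_norm_sq_to_K] at h1
      have h2 : ‖y‖ * ‖y‖ ≤ 4 * C * (‖w - c‖ / R) ^ 2 * ‖y‖ := by
        have : ‖y‖ * ‖y‖ ≤ 4 * (C * ‖y‖) * (‖w - c‖ / R) ^ 2 := by simpa [sq] using h1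
        linarith
      exact le_of_mul_le_mul_right h2 (lt_of_le_of_ne (norm_nonneg _) (Ne.symm h0))
  have hder : HasFDerivAt F (Λ.mkContinuous _ hΛ) c := by
    refine .of_isLittleO ?_
    refine (Asymptotics.IsBigO.of_bound (g := fun w => ‖w - c‖ ^ 2)
      (4 * C / R ^ 2) ?_).trans_isLittleO ?_
    · filter_upwards [Metric.ball_mem_nhds c hR] with w hw
      refine (hrem w hw).trans_eq ?_
      simp; ring
    · have := (Asymptotics.isLittleO_norm_pow_id (E' := X) one_lt_two).comp_tendsto
        (show Tendsto (fun w => w - c) (𝓝 c) (𝓝 0) by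
          have : Continuous fun w : X => w - c := by fun_prop
          simpa using this.tendsto c)
      exact this
  exact hder.differentiableAt.differentiableWithinAt

/-- Directional derivatives of a holomorphic function are holomorphic. -/
theorem differentiableOn_fderiv_apply [CompleteSpace G] {F : X → G} {U : Set X} (hU : IsOpen U)
    (hF : DifferentiableOn ℂ F U) (v : X) : DifferentiableOn ℂ (fun u => fderiv ℂ F u v) U := by
  intro x hx
  -- Nested balls: `F` is bounded on radius `4R`, its difference quotients are controlled on `2R`,
  -- and their derivatives on `R`.
  obtain ⟨R, C, hR, hRU, hC⟩ : ∃ R C : ℝ, 0 < R ∧ Metric.ball x (4 * R) ⊆ U ∧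
      ∀ y ∈ Metric.ball x (4 * R), ‖F y‖ ≤ C := by
    have hb : ∀ᶠ y in 𝓝 x, ‖F y‖ < ‖F x‖ + 1 :=
      (hF.continuousOn.continuousAt (hU.mem_nhds hx)).norm.eventually_lt_const (by linarith)
    obtain ⟨ε, hε, h⟩ := Metric.nhds_basis_ball.mem_iff.mp (inter_mem (hU.mem_nhds hx) hb)
    refine ⟨ε / 4, ‖F x‖ + 1, by positivity, ?_, ?_⟩
    · rw [mul_div_cancel₀ _ four_ne_zero]; exact fun y hy => (h hy).1
    · rw [mul_div_cancel₀ _ four_ne_zero]; exact fun y hy => (h hy).2.le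
  have hC0 : 0 ≤ C := (norm_nonneg _).trans (hC x (Metric.mem_ball_self (by positivity)))
  let g : ℂ → X → G := fun t y => t⁻¹ • (F (y + t • v) - F y)
  set A : ℝ := C * ‖v‖ ^ 2 / R ^ 2 with hA
  have hA0 : 0 ≤ A := by positivity
  have hsub : ∀ y ∈ Metric.ball x (2 * R), Metric.ball y (2 * R) ⊆ Metric.ball x (4 * R) := by
    intro y hy
    refine Metric.ball_subset_ball' ?_
    rw [Metric.mem_ball] at hy
    linarith
  -- The Taylor remainder on the ball of radius `2R` about `y` gives `4C(‖t • v‖/2R)² / ‖t‖ = A‖t‖`.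
  have hquot : ∀ t : ℂ, t ≠ 0 → ‖t • v‖ < R → ∀ y ∈ Metric.ball x (2 * R),
      ‖g t y - fderiv ℂ F y v‖ ≤ A * ‖t‖ := by
    intro t ht htR y hy
    have h1 := norm_taylor_remainder_le (w := y + t • v) (hF.mono ((hsub y hy).trans hRU))
      (fun u hu => hC u (hsub y hy hu)) (by simpa using htR.trans (by linarith))
    have h2 : g t y - fderiv ℂ F y v =
        t⁻¹ • (F (y + t • v) - F y - fderiv ℂ F y (y + t • v - y)) := by
      simp [g, smul_sub, smul_smul, ht]
    have ht' : 0 < ‖t‖ := norm_pos_iff.mpr ht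
    rw [h2, norm_smul, norm_inv, inv_mul_le_iff₀ ht']
    refine h1.trans_eq ?_
    rw [add_sub_cancel_left, norm_smul, hA]
    field_simp
    ring
  have hdiff : ∀ t : ℂ, ‖t • v‖ < R → DifferentiableOn ℂ (g t) (Metric.ball x (2 * R)) := by
    intro t htR
    refine DifferentiableOn.const_smul (DifferentiableOn.sub ?_ ?_) _
    · refine hF.comp (differentiable_id.add_const _).differentiableOn fun y hy => hRU ?_
      exact hsub y hy (by simpa using htR.trans (by linarith))
    · exact hF.mono ((Metric.ball_subset_ball (by linarith)).trans hRU)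
  have hsmall : ∀ᶠ t : ℂ in 𝓝[≠] 0, t ≠ 0 ∧ ‖t • v‖ < R := by
    refine (eventually_mem_nhdsWithin).and (eventually_nhdsWithin_of_eventually_nhds ?_)
    have : Continuous fun t : ℂ => ‖t • v‖ := by fun_prop
    exact (this.tendsto 0).eventually_lt_const (by simpa using hR)
  have hsub' : ∀ y ∈ Metric.ball x R, Metric.ball y R ⊆ Metric.ball x (2 * R) := by
    intro y hy
    refine Metric.ball_subset_ball' ?_
    rw [Metric.mem_ball] at hy
    linarith
  have hR2 : Metric.ball x R ⊆ Metric.ball x (2 * R) := Metric.ball_subset_ball (by linarith)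
  -- Cauchy's estimate converts uniform closeness of two quotients on `2R` into uniform closeness of
  -- their derivatives on `R`, so the limit of the quotients is differentiable.
  have hcauchy : UniformCauchySeqOn (fun t y => fderiv ℂ (g t) y) (𝓝[≠] (0 : ℂ))
      (Metric.ball x R) := by
    intro s hs
    obtain ⟨ε, hε, hεs⟩ := Metric.mem_uniformity_dist.mp hs
    have hlim : Tendsto (fun p : ℂ × ℂ => 2 * (A * ‖p.1‖ + A * ‖p.2‖) / R)
        (𝓝[≠] 0 ×ˢ 𝓝[≠] 0) (𝓝 0) := by
      have : Continuous fun p : ℂ × ℂ => 2 * (A * ‖p.1‖ + A * ‖p.2‖) / R := by fun_prop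
      have h0 := this.tendsto (0, 0)
      rw [nhds_prod_eq] at h0
      simpa using h0.mono_left (prod_mono nhdsWithin_le_nhds nhdsWithin_le_nhds)
    filter_upwards [hsmall.prod_mk hsmall, hlim.eventually_lt_const hε] with p hp hpε y hy
    refine hεs ((dist_eq_norm _ _).trans_lt (lt_of_le_of_lt ?_ hpε))
    have hat : ∀ t : ℂ, ‖t • v‖ < R → DifferentiableAt ℂ (g t) y := fun t ht =>
      (hdiff t ht).differentiableAt (Metric.isOpen_ball.mem_nhds (hR2 hy))
    rw [← fderiv_sub (hat _ hp.1.2) (hat _ hp.2.2)]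
    refine norm_fderiv_le_of_norm_le
      (((hdiff _ hp.1.2).sub (hdiff _ hp.2.2)).mono (hsub' y hy)) (fun u hu => ?_) hR
    have h1 := hquot _ hp.1.1 hp.1.2 u (hsub' y hy hu)
    have h2 := hquot _ hp.2.1 hp.2.2 u (hsub' y hy hu)
    have h3 := norm_sub_le (g p.1 u - fderiv ℂ F u v) (g p.2 u - fderiv ℂ F u v)
    rw [sub_sub_sub_cancel_right] at h3
    exact h3.trans (add_le_add h1 h2)
  have hex : ∀ y, ∃ l : X →L[ℂ] G, y ∈ Metric.ball x R →
      Tendsto (fun t => fderiv ℂ (g t) y) (𝓝[≠] (0 : ℂ)) (𝓝 l) := fun y => by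
    by_cases hy : y ∈ Metric.ball x R
    · obtain ⟨l, hl⟩ := CompleteSpace.complete (hcauchy.cauchy_map hy)
      exact ⟨l, fun _ => hl⟩
    · exact ⟨0, fun h => (hy h).elim⟩
  choose g' hg' using hex
  have hunif := hcauchy.tendstoUniformlyOn_of_tendsto hg'
  have hxR : Metric.ball x R ∈ 𝓝 x := Metric.ball_mem_nhds x hR
  refine (hasFDerivAt_of_tendstoUniformlyOnFilter (l := 𝓝[≠] (0 : ℂ)) (f := g)
    (hunif.tendstoUniformlyOnFilter.mono_right (le_principal_iff.mpr hxR)) ?_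
    (?_ : ∀ᶠ y in 𝓝 x, Tendsto (fun t => g t y) _ (𝓝 (fderiv ℂ F y v)))
    ).differentiableAt.differentiableWithinAt
  · filter_upwards [hsmall.prod_mk hxR] with p hp
    exact ((hdiff p.1 hp.1.2).differentiableAt
      (Metric.isOpen_ball.mem_nhds (hR2 hp.2))).hasFDerivAt
  · filter_upwards [hxR] with y hy
    rw [tendsto_iff_norm_sub_tendsto_zero]
    refine squeeze_zero' (Eventually.of_forall fun _ => norm_nonneg _)
      (hsmall.mono fun t ht => hquot t ht.1 ht.2 y (hR2 hy)) ?_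
    have : Continuous fun t : ℂ => A * ‖t‖ := by fun_prop
    simpa using (this.tendsto 0).mono_left (nhdsWithin_le_nhds (s := {0}ᶜ))

end Holomorphic

/-! ### Curvature of a frame and its independence of the frame -/

section FrameCurvature

variable {m : ℕ} {E : Type*} [NormedAddCommGroup E] [InnerProductSpace ℂ E]

/-- Coordinatewise conjugation on `ℂ^m` as a real linear map. -/
def conjCLM (m : ℕ) : (Fin m → ℂ) →L[ℝ] (Fin m → ℂ) :=
  ContinuousLinearMap.pi fun i =>
    (Complex.conjCLE : ℂ →L[ℝ] ℂ).comp (ContinuousLinearMap.proj i)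

theorem conjCLM_apply (v : Fin m → ℂ) : conjCLM m v = star v := by
  ext i; simp [conjCLM]

theorem star_single_I (i : Fin m) :
    star (Pi.single i Complex.I : Fin m → ℂ) = (-Complex.I) • Pi.single i (1 : ℂ) := by
  ext l
  by_cases h : l = i
  · subst h; simp
  · simp [h]

theorem star_single_one (i : Fin m) :
    star (Pi.single i 1 : Fin m → ℂ) = Pi.single i (1 : ℂ) := by
  ext l
  by_cases h : l = i
  · subst h; simp
  · simp [h]

/-- The real derivative of `v ↦ γ v̄`. -/
theorem hasFDerivAt_comp_star {γ : (Fin m → ℂ) → E} {w : Fin m → ℂ}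
    (h : DifferentiableAt ℂ γ (star w)) :
    HasFDerivAt (fun v => γ (star v))
      (((fderiv ℂ γ (star w)).restrictScalars ℝ).comp (conjCLM m)) w := by
  have h1 : HasFDerivAt (conjCLM m) (conjCLM m) w := (conjCLM m).hasFDerivAt
  have h2 : HasFDerivAt γ ((fderiv ℂ γ (star w)).restrictScalars ℝ) (conjCLM m w) := by
    rw [conjCLM_apply]
    exact h.hasFDerivAt.restrictScalars ℝ
  have h3 := h2.comp w h1
  refine h3.congr_of_eventuallyEq (Eventually.of_forall fun v => ?_)
  simp [conjCLM_apply]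

section Inner

variable {α β : (Fin m → ℂ) → E} {w : Fin m → ℂ}

theorem hasFDerivAt_inner_comp_star (hα : DifferentiableAt ℂ α (star w))
    (hβ : DifferentiableAt ℂ β (star w)) :
    HasFDerivAt (fun v => inner ℂ (α (star v)) (β (star v)))
      ((fderivInnerCLM ℂ (α (star w), β (star w))).comp
        ((((fderiv ℂ α (star w)).restrictScalars ℝ).comp (conjCLM m)).prod
          (((fderiv ℂ β (star w)).restrictScalars ℝ).comp (conjCLM m)))) w :=
  (hasFDerivAt_comp_star hα).inner ℂ (hasFDerivAt_comp_star hβ)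

/-- Conjugating the variable makes `α` and `β` antiholomorphic, and the first slot of the inner
product conjugates once more. So `∂_i` sees only the first slot and `∂̄_j` only the second. -/
theorem wirtinger_inner_comp_star (hα : DifferentiableAt ℂ α (star w))
    (hβ : DifferentiableAt ℂ β (star w)) (i : Fin m) :
    wirtinger i (fun v => inner ℂ (α (star v)) (β (star v))) w =
      inner ℂ (fderiv ℂ α (star w) (Pi.single i 1)) (β (star w)) := by
  rw [wirtinger, (hasFDerivAt_inner_comp_star hα hβ).fderiv]
  simp only [ContinuousLinearMap.comp_apply, ContinuousLinearMap.prod_apply,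
    fderivInnerCLM_apply, conjCLM_apply, star_single_I, star_single_one, map_smul,
    ContinuousLinearMap.coe_restrictScalars', inner_smul_left, inner_smul_right, map_neg,
    Complex.conj_I]
  linear_combination (-inner ℂ (fderiv ℂ α (star w) (Pi.single i 1)) (β (star w)) / 2 +
    inner ℂ (α (star w)) (fderiv ℂ β (star w) (Pi.single i 1)) / 2) * Complex.I_mul_I

theorem wirtingerBar_inner_comp_star (hα : DifferentiableAt ℂ α (star w))
    (hβ : DifferentiableAt ℂ β (star w)) (j : Fin m) :
    wirtingerBar j (fun v => inner ℂ (α (star v)) (β (star v))) w =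
      inner ℂ (α (star w)) (fderiv ℂ β (star w) (Pi.single j 1)) := by
  rw [wirtingerBar, (hasFDerivAt_inner_comp_star hα hβ).fderiv]
  simp only [ContinuousLinearMap.comp_apply, ContinuousLinearMap.prod_apply,
    fderivInnerCLM_apply, conjCLM_apply, star_single_I, star_single_one, map_smul,
    ContinuousLinearMap.coe_restrictScalars', inner_smul_left, inner_smul_right, map_neg,
    Complex.conj_I]
  linear_combination (inner ℂ (fderiv ℂ α (star w) (Pi.single j 1)) (β (star w)) / 2 -
    inner ℂ (α (star w)) (fderiv ℂ β (star w) (Pi.single j 1)) / 2) * Complex.I_mul_I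

end Inner

theorem wirtingerBar_comp {φ : ℂ → ℂ} {φ' : ℂ} {f : (Fin m → ℂ) → ℂ} {w : Fin m → ℂ}
    (hφ : HasDerivAt φ φ' (f w)) (hf : DifferentiableAt ℝ f w) (j : Fin m) :
    wirtingerBar j (fun v => φ (f v)) w = φ' * wirtingerBar j f w := by
  have h := (hφ.hasFDerivAt.restrictScalars ℝ).comp w hf.hasFDerivAt
  rw [wirtingerBar, wirtingerBar, show (fun v => φ (f v)) = φ ∘ f from rfl, h.fderiv]
  simp
  ring

theorem wirtinger_div {p q : (Fin m → ℂ) → ℂ} {w : Fin m → ℂ}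
    (hp : DifferentiableAt ℝ p w) (hq : DifferentiableAt ℝ q w) (h0 : q w ≠ 0) (i : Fin m) :
    wirtinger i (fun v => p v / q v) w =
      wirtinger i p w / q w - p w * wirtinger i q w / q w ^ 2 := by
  have hinv := ((hasDerivAt_inv h0).hasFDerivAt.restrictScalars ℝ).comp w hq.hasFDerivAt
  have h := hp.hasFDerivAt.mul hinv
  have h' : (fun v => p v / q v) = p * (fun v => (Inv.inv ∘ q) v) := by
    ext v; simp [div_eq_mul_inv]
  rw [wirtinger, h', h.fderiv]
  simp [wirtinger]
  field_simp
  ring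

/-- The curvature in terms of the first order jet of a frame. -/
theorem frameCurvature_apply [CompleteSpace E] {γ : (Fin m → ℂ) → E} {U : Set (Fin m → ℂ)}
    (hU : IsOpen U) (hγ : DifferentiableOn ℂ γ U) (hne : ∀ u ∈ U, γ u ≠ 0) {w : Fin m → ℂ}
    (hw : star w ∈ U) (i j : Fin m) :
    frameCurvature γ w i j =
      -(inner ℂ (fderiv ℂ γ (star w) (Pi.single i 1)) (fderiv ℂ γ (star w) (Pi.single j 1)) /
          inner ℂ (γ (star w)) (γ (star w)) -
        inner ℂ (γ (star w)) (fderiv ℂ γ (star w) (Pi.single j 1)) *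
          inner ℂ (fderiv ℂ γ (star w) (Pi.single i 1)) (γ (star w)) /
          inner ℂ (γ (star w)) (γ (star w)) ^ 2) := by
  have hγa : ∀ u ∈ U, DifferentiableAt ℂ γ u := fun u hu => hγ.differentiableAt (hU.mem_nhds hu)
  have hγ' : ∀ u ∈ U, DifferentiableAt ℂ (fun u => fderiv ℂ γ u (Pi.single j 1)) u := fun u hu =>
    (differentiableOn_fderiv_apply hU hγ _).differentiableAt (hU.mem_nhds hu)
  have hbar : ∀ v, star v ∈ U →
      wirtingerBar j (fun v => ((Real.log (‖γ (star v)‖ ^ 2) : ℝ) : ℂ)) v =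
        inner ℂ (γ (star v)) (fderiv ℂ γ (star v) (Pi.single j 1)) /
          inner ℂ (γ (star v)) (γ (star v)) := by
    intro v hv
    -- The complex logarithm agrees with the real one on positive numbers, so the holomorphic chain
    -- rule applies.
    have h1 : (fun v => ((Real.log (‖γ (star v)‖ ^ 2) : ℝ) : ℂ)) =
        fun v => Complex.log (inner ℂ (γ (star v)) (γ (star v))) := by
      ext v
      rw [inner_self_eq_norm_sq_to_K, Complex.ofReal_log (by positivity)]
      simp
    have hslit : inner ℂ (γ (star v)) (γ (star v)) ∈ Complex.slitPlane := by
      have hpos : 0 < ‖γ (star v)‖ ^ 2 := by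
        have := norm_pos_iff.mpr (hne _ hv)
        positivity
      rw [inner_self_eq_norm_sq_to_K]
      exact_mod_cast Complex.ofReal_mem_slitPlane.mpr hpos
    rw [h1, wirtingerBar_comp (f := fun v => inner ℂ (γ (star v)) (γ (star v)))
      (Complex.hasDerivAt_log hslit)
      (hasFDerivAt_inner_comp_star (hγa _ hv) (hγa _ hv)).differentiableAt,
      wirtingerBar_inner_comp_star (hγa _ hv) (hγa _ hv)]
    ring
  have hev : wirtingerBar j (fun v => ((Real.log (‖γ (star v)‖ ^ 2) : ℝ) : ℂ)) =ᶠ[𝓝 w]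
      fun v => inner ℂ (γ (star v)) (fderiv ℂ γ (star v) (Pi.single j 1)) /
          inner ℂ (γ (star v)) (γ (star v)) := by
    have : ∀ᶠ v in 𝓝 w, star v ∈ U := continuous_star.continuousAt (hU.mem_nhds hw)
    exact this.mono hbar
  have hcongr : wirtinger i (wirtingerBar j fun v => ((Real.log (‖γ (star v)‖ ^ 2) : ℝ) : ℂ)) w =
      wirtinger i (fun v => inner ℂ (γ (star v)) (fderiv ℂ γ (star v) (Pi.single j 1)) /
          inner ℂ (γ (star v)) (γ (star v))) w := by
    rw [wirtinger, wirtinger, hev.fderiv_eq]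
  rw [frameCurvature, Matrix.of_apply, hcongr, wirtinger_div
    (p := fun v => inner ℂ (γ (star v)) (fderiv ℂ γ (star v) (Pi.single j 1)))
    (q := fun v => inner ℂ (γ (star v)) (γ (star v)))
    (hasFDerivAt_inner_comp_star (hγa _ hw) (hγ' _ hw)).differentiableAt
    (hasFDerivAt_inner_comp_star (hγa _ hw) (hγa _ hw)).differentiableAt
    (inner_self_ne_zero.mpr (hne _ hw)),
    wirtinger_inner_comp_star (β := fun u => fderiv ℂ γ u (Pi.single j 1)) (hγa _ hw) (hγ' _ hw),
    wirtinger_inner_comp_star (hγa _ hw) (hγa _ hw)]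

/-- Two holomorphic frames of the same line bundle have the same curvature. -/
theorem frameCurvature_eq_of_isHolomorphicFrame [CompleteSpace E] {T : Fin m → E →L[ℂ] E}
    {U₁ U₂ : Set (Fin m → ℂ)} {γ₁ γ₂ : (Fin m → ℂ) → E} (h₁ : IsHolomorphicFrame T U₁ γ₁)
    (h₂ : IsHolomorphicFrame T U₂ γ₂) {w : Fin m → ℂ} (hw₁ : star w ∈ U₁) (hw₂ : star w ∈ U₂) :
    frameCurvature γ₁ w = frameCurvature γ₂ w := by
  set a := γ₁ (star w) with ha
  have hd₁ := h₁.differentiableOn.differentiableAt (h₁.isOpen.mem_nhds hw₁)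
  have hd₂ := h₂.differentiableOn.differentiableAt (h₂.isOpen.mem_nhds hw₂)
  have ha0 : a ≠ 0 := h₁.ne_zero _ hw₁
  -- The transition function, read off by pairing both frames with the fixed vector `a`; this makes
  -- its holomorphy visible.
  let c : (Fin m → ℂ) → ℂ := fun u => inner ℂ a (γ₂ u) * (inner ℂ a (γ₁ u))⁻¹
  have hd₁' : DifferentiableAt ℂ (fun u => inner ℂ a (γ₁ u)) (star w) :=
    (innerSL ℂ a).differentiableAt.comp _ hd₁
  have hd₂' : DifferentiableAt ℂ (fun u => inner ℂ a (γ₂ u)) (star w) :=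
    (innerSL ℂ a).differentiableAt.comp _ hd₂
  have hne : (fun u => inner ℂ a (γ₁ u)) (star w) ≠ 0 := inner_self_ne_zero.mpr ha0
  have hc : DifferentiableAt ℂ c (star w) :=  hd₂'.fun_mul (hd₁'.fun_inv hne)
  have hev : γ₂ =ᶠ[𝓝 (star w)] fun u => c u • γ₁ u := by
    filter_upwards [h₁.isOpen.mem_nhds hw₁, h₂.isOpen.mem_nhds hw₂,
      hd₁'.continuousAt.eventually_ne hne] with u hu₁ hu₂ hu
    have hmem : γ₂ u ∈ Submodule.span ℂ {γ₁ u} := by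
      rw [h₁.span_eq u hu₁, ← h₂.span_eq u hu₂]
      exact Submodule.mem_span_singleton_self _
    obtain ⟨r, hr⟩ := Submodule.mem_span_singleton.mp hmem
    rw [← hr]
    congr 1
    simp only [c]
    rw [← hr, inner_smul_right, mul_inv_cancel_right₀ hu]
  have hval : γ₂ (star w) = c (star w) • a := hev.eq_of_nhds
  have hc0 : c (star w) ≠ 0 := fun h => h₂.ne_zero _ hw₂ (by rw [hval, h, zero_smul])
  have hder : ∀ x, fderiv ℂ γ₂ (star w) x =
      c (star w) • fderiv ℂ γ₁ (star w) x + fderiv ℂ c (star w) x • a := fun x => by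
    rw [hev.fderiv_eq, fderiv_fun_smul hc hd₁]
    simp [ha]
  ext i j
  rw [frameCurvature_apply h₁.isOpen h₁.differentiableOn h₁.ne_zero hw₁,
    frameCurvature_apply h₂.isOpen h₂.differentiableOn h₂.ne_zero hw₂, hder, hder, hval, ← ha]
  have hg : inner ℂ a a ≠ 0 := inner_self_ne_zero.mpr ha0
  have hc0' : conj (c (star w)) ≠ 0 := (map_ne_zero _).mpr hc0
  -- The multiples of `a` coming from the derivative of `c` drop out of the Gram determinant; what
  -- is left scales by `|c|⁴`, as does `‖γ‖⁴`.
  simp only [inner_add_left, inner_add_right, inner_smul_left, inner_smul_right]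
  field_simp
  ring

end FrameCurvature

/-! ### The kernel of `𝒜₀` and the projection of elementary tensors -/

section DiagonalKernel

variable {X : Type*} (H : Type*) [NormedAddCommGroup H] [InnerProductSpace ℂ H]

/-- The bilinear map `(f, g) ↦ f ⊗ g` into the Hilbert space tensor product. -/
def tmulL : H →L[ℂ] H →L[ℂ] HilbertTensor H H :=
  (ContinuousLinearMap.compL ℂ H (H ⊗[ℂ] H) (HilbertTensor H H)
    UniformSpace.Completion.toComplL).comp (TensorProduct.mkL ℂ H H)

variable {H}

theorem tmulL_apply (f g : H) :
    tmulL H f g = ((f ⊗ₜ[ℂ] g : H ⊗[ℂ] H) : HilbertTensor H H) := rfl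

theorem inner_tmulL (f g f' g' : H) :
    inner ℂ (tmulL H f g) (tmulL H f' g') = inner ℂ f f' * inner ℂ g g' := by
  simp [tmulL_apply]

variable [CompleteSpace H] [RKHS ℂ H X ℂ]

theorem tmulL_eval (f g : H) (x y : X) : tmulL H f g (x, y) = f x * g y :=
  tensorEval_tmul H H f g x y

theorem scalarKernel_eq_inner {Y : Type*} (G : Type*) [NormedAddCommGroup G]
    [InnerProductSpace ℂ G] [CompleteSpace G] [RKHS ℂ G Y ℂ] (x y : Y) :
    scalarKernel G x y = inner ℂ (RKHS.kerFun G x (1 : ℂ)) (RKHS.kerFun G y (1 : ℂ)) := by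
  rw [RKHS.kerFun_inner, RKHS.kerFun_apply]
  simp [scalarKernel]

theorem inner_tmulL_kerFun (f : HilbertTensor H H) (x y : X) :
    inner ℂ (tmulL H (RKHS.kerFun H x (1 : ℂ)) (RKHS.kerFun H y (1 : ℂ))) f = f (x, y) := rfl

/-- Evaluation on a closed subspace is represented by the projection of the ambient kernel function.
-/
theorem kerFun_diagVanishing (x y : X) :
    RKHS.kerFun (diagVanishing H) (x, y) (1 : ℂ) =
      (diagVanishing H).orthogonalProjectionOnto
        (tmulL H (RKHS.kerFun H x (1 : ℂ)) (RKHS.kerFun H y (1 : ℂ))) := by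
  refine ext_inner_right ℂ fun f => ?_
  rw [RKHS.kerFun_inner, Submodule.inner_orthogonalProjectionOnto_eq_of_mem_right,
    inner_tmulL_kerFun]
  simp
  rfl

/-- The `𝒜₀`-component of `a ⊗ f`. -/
def projTmul (a : H) : H →L[ℂ] diagVanishing H :=
  (diagVanishing H).orthogonalProjectionOnto.comp (tmulL H a)

theorem scalarKernel_diagVanishing (x y y' : X) :
    scalarKernel (diagVanishing H) (x, y) (x, y') =
      inner ℂ (projTmul (RKHS.kerFun H x (1 : ℂ)) (RKHS.kerFun H y (1 : ℂ)))
        (projTmul (RKHS.kerFun H x (1 : ℂ)) (RKHS.kerFun H y' (1 : ℂ))) := by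
  rw [scalarKernel_eq_inner, kerFun_diagVanishing, kerFun_diagVanishing]
  rfl

theorem tmulL_kerFun_self_mem_orthogonal (x : X) :
    tmulL H (RKHS.kerFun H x (1 : ℂ)) (RKHS.kerFun H x (1 : ℂ)) ∈ (diagVanishing H)ᗮ := by
  rw [Submodule.mem_orthogonal']
  intro f hf
  rw [inner_tmulL_kerFun]
  exact hf x

theorem projTmul_kerFun_self (x : X) :
    projTmul (RKHS.kerFun H x (1 : ℂ)) (RKHS.kerFun H x (1 : ℂ)) = 0 := by
  rw [projTmul, ContinuousLinearMap.comp_apply]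
  exact Submodule.orthogonalProjectionOnto_apply_of_mem_orthogonal
    (tmulL_kerFun_self_mem_orthogonal x)

theorem tmulL_sub_tmulL_mem_diagVanishing (f g : H) :
    tmulL H f g - tmulL H g f ∈ diagVanishing H := by
  intro x
  simp [tmulL_eval, mul_comm]

/-- If the symmetrization of `a ⊗ b` is orthogonal to `𝒜₀`, then its `𝒜₀`-component is its
antisymmetrization. -/
theorem coe_projTmul_of_mem_orthogonal {a b : H}
    (h : tmulL H a b + tmulL H b a ∈ (diagVanishing H)ᗮ) :
    (projTmul a b : HilbertTensor H H) = (2⁻¹ : ℂ) • (tmulL H a b - tmulL H b a) := by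
  -- `a ⊗ b` is half its antisymmetrization, which lies in `𝒜₀`, plus half its symmetrization, which
  -- is orthogonal to `𝒜₀`.
  have := Submodule.eq_starProjection_of_mem_orthogonal' (K := diagVanishing H)
    (u := tmulL H a b) (v := (2⁻¹ : ℂ) • (tmulL H a b - tmulL H b a))
    (z := (2⁻¹ : ℂ) • (tmulL H a b + tmulL H b a))
    (Submodule.smul_mem _ _ (tmulL_sub_tmulL_mem_diagVanishing a b))
    (Submodule.smul_mem _ _ h) (by module)
  rw [← this]
  rfl

theorem inner_projTmul_of_mem_orthogonal {a b b' : H}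
    (h : tmulL H a b + tmulL H b a ∈ (diagVanishing H)ᗮ)
    (h' : tmulL H a b' + tmulL H b' a ∈ (diagVanishing H)ᗮ) :
    inner ℂ (projTmul a b) (projTmul a b') =
      (inner ℂ a a * inner ℂ b b' - inner ℂ a b' * inner ℂ b a) / 2 := by
  rw [Submodule.coe_inner, coe_projTmul_of_mem_orthogonal h, coe_projTmul_of_mem_orthogonal h']
  simp only [inner_smul_left, inner_smul_right, inner_sub_left, inner_sub_right, inner_tmulL,
    map_inv₀, map_ofNat]
  ring

end DiagonalKernel

/-! ### Holomorphy of the kernel section and limits of difference quotients -/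

section KernelFrame

variable {m : ℕ} {Ω₀ : Set (Fin m → ℂ)} (H : Type*)
  [NormedAddCommGroup H] [InnerProductSpace ℂ H] [RKHS ℂ H Ω₀ ℂ] [CompleteSpace H]

open Classical in
/-- The antiholomorphic kernel `u ↦ K(·, ū)`, extended by zero. -/
def kernelSection (Ω₀ : Set (Fin m → ℂ)) (H : Type*) [NormedAddCommGroup H]
    [InnerProductSpace ℂ H] [RKHS ℂ H Ω₀ ℂ] [CompleteSpace H] (u : Fin m → ℂ) : H :=
  if h : star u ∈ Ω₀ then RKHS.kerFun H (⟨star u, h⟩ : Ω₀) (1 : ℂ) else 0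

variable {H}

theorem kernelSection_of_mem {u : Fin m → ℂ} (h : star u ∈ Ω₀) :
    kernelSection Ω₀ H u = RKHS.kerFun H (⟨star u, h⟩ : Ω₀) (1 : ℂ) := dif_pos h

theorem kernelSection_star (x : Ω₀) :
    kernelSection Ω₀ H (star (x : Fin m → ℂ)) = RKHS.kerFun H x (1 : ℂ) := by
  rw [kernelSection_of_mem (by simp)]
  congr
  simp

theorem isOpen_conjSet (h : IsOpen Ω₀) : IsOpen (conjSet Ω₀) := h.preimage continuous_star

theorem differentiableOn_star_comp_star {f : (Fin m → ℂ) → ℂ} {U : Set (Fin m → ℂ)}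
    (hU : IsOpen U) (hf : DifferentiableOn ℂ f U) :
    DifferentiableOn ℂ (fun u => conj (f (star u))) (conjSet U) := by
  intro u hu
  have hd := (hf.differentiableAt (hU.mem_nhds hu))
  have h := hasFDerivAt_comp_star (w := u) hd
  have h2 := (Complex.conjCLE : ℂ →L[ℝ] ℂ).hasFDerivAt.comp u h
  let L : (Fin m → ℂ) →L[ℂ] ℂ :=
    { toFun := fun v => conj (fderiv ℂ f (star u) (star v))
      map_add' := fun v w => by simp
      map_smul' := fun c v => by simp
      cont := by fun_prop }
  refine (hasFDerivAt_of_restrictScalars ℝ (f' := L) h2 ?_).differentiableAt.differentiableWithinAt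
  ext v
  simp [L, conjCLM_apply]

/-- Pairing with `f` gives the conjugate of `f(ū)`, so the section is weakly holomorphic, hence
holomorphic. -/
theorem differentiableOn_kernelSection (hΩ₀ : IsOpen Ω₀) (hol : ConsistsOfHolomorphic Ω₀ H) :
    DifferentiableOn ℂ (kernelSection Ω₀ H) (conjSet Ω₀) := by
  refine differentiableOn_of_inner (isOpen_conjSet hΩ₀) fun f => ?_
  refine (differentiableOn_star_comp_star hΩ₀ (hol f)).congr fun u hu => ?_
  rw [kernelSection_of_mem (Ω₀ := Ω₀) hu, RKHS.inner_kerFun]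
  have := Subtype.val_injective.extend_apply (f : Ω₀ → ℂ) 0 (⟨star u, hu⟩ : Ω₀)
  rw [this]
  simp

/-- The symmetrization of `K_z ⊗ ∂K_z` is orthogonal to the functions vanishing on the
diagonal. -/
theorem tmulL_add_tmulL_fderiv_mem_orthogonal (hΩ₀ : IsOpen Ω₀)
    (hol : ConsistsOfHolomorphic Ω₀ H) {u : Fin m → ℂ} (hu : star u ∈ Ω₀) (v : Fin m → ℂ) :
    tmulL H (kernelSection Ω₀ H u) (fderiv ℂ (kernelSection Ω₀ H) u v) +
      tmulL H (fderiv ℂ (kernelSection Ω₀ H) u v) (kernelSection Ω₀ H u) ∈ (diagVanishing H)ᗮ := by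
  rw [Submodule.mem_orthogonal]
  intro f hf
  have hmem : conjSet Ω₀ ∈ 𝓝 u := (isOpen_conjSet hΩ₀).mem_nhds hu
  have hd := ((differentiableOn_kernelSection hΩ₀ hol).differentiableAt hmem).hasFDerivAt
  have h1 := ((innerSL ℂ f).hasFDerivAt).comp u ((tmulL H).hasFDerivAt_of_bilinear hd hd)
  have h2 : HasFDerivAt (fun _ => (0 : ℂ)) (0 : (Fin m → ℂ) →L[ℂ] ℂ) u := hasFDerivAt_const _ _
  -- Near `u` the function `w ↦ ⟨f, K_w̄ ⊗ K_w̄⟩` is identically zero; the product rule splits its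
  -- zero derivative into the two tensors.
  have h3 := h1.unique (h2.congr_of_eventuallyEq ?_)
  · simpa [inner_add_right] using congrArg (fun L => L v) h3
  · filter_upwards [hmem] with w hw
    simp only [Function.comp_apply, innerSL_apply_apply]
    rw [kernelSection_of_mem (Ω₀ := Ω₀) hw]
    exact Submodule.inner_right_of_mem_orthogonal hf (tmulL_kerFun_self_mem_orthogonal _)

/-- Difference quotients of the kernel along a coordinate line. -/
theorem tendsto_kernelSection_slope (hΩ₀ : IsOpen Ω₀) (hol : ConsistsOfHolomorphic Ω₀ H)
    (z : Ω₀) (i : Fin m) :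
    Tendsto (fun ζ : Ω₀ => (conj (ζ.1 i) - conj (z.1 i))⁻¹ •
        (RKHS.kerFun H ζ (1 : ℂ) - RKHS.kerFun H z (1 : ℂ)))
      (𝓝[{ζ : Ω₀ | ζ.1 i ≠ z.1 i ∧ ∀ l, l ≠ i → ζ.1 l = z.1 l}] z)
      (𝓝 (fderiv ℂ (kernelSection Ω₀ H) (star z.1) (Pi.single i 1))) := by
  have hmem : conjSet Ω₀ ∈ 𝓝 (star z.1) := (isOpen_conjSet hΩ₀).mem_nhds (by simp [conjSet])
  have hd := ((differentiableOn_kernelSection hΩ₀ hol).differentiableAt hmem).hasFDerivAt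
  have hline := (hd.hasLineDerivAt (Pi.single i 1)).tendsto_slope_zero
  have ht : Tendsto (fun ζ : Ω₀ => conj (ζ.1 i) - conj (z.1 i))
      (𝓝[{ζ : Ω₀ | ζ.1 i ≠ z.1 i ∧ ∀ l, l ≠ i → ζ.1 l = z.1 l}] z) (𝓝[≠] 0) := by
    refine tendsto_nhdsWithin_iff.mpr ⟨?_, ?_⟩
    · have : Continuous fun ζ : Ω₀ => conj (ζ.1 i) - conj (z.1 i) :=
        (Complex.continuous_conj.comp
          ((continuous_apply i).comp continuous_subtype_val)).sub continuous_const
      simpa using (this.tendsto z).mono_left nhdsWithin_le_nhds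
    · filter_upwards [self_mem_nhdsWithin] with ζ hζ
      exact sub_ne_zero.mpr fun h => hζ.1 ((starRingEnd ℂ).injective h)
  refine (hline.comp ht).congr' ?_
  filter_upwards [self_mem_nhdsWithin] with ζ hζ
  have hζ' : star z.1 + (conj (ζ.1 i) - conj (z.1 i)) • Pi.single i (1 : ℂ) = star ζ.1 := by
    ext l
    by_cases h : l = i
    · subst h; simp
    · simp [h, hζ.2 l h]
  simp only [Function.comp_apply]
  rw [hζ', kernelSection_star, kernelSection_star]

/-- The projection kills `K_z ⊗ K_z`, so the quotient is exactly an inner product of projected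
slopes, each of which converges. The two limits are therefore independent. -/
theorem tendsto_scalarKernel_diagVanishing (hΩ₀ : IsOpen Ω₀) (hol : ConsistsOfHolomorphic Ω₀ H)
    (z : Ω₀) (i j : Fin m) :
    Tendsto
      (fun p : Ω₀ × Ω₀ =>
        scalarKernel (diagVanishing H) (z, p.1) (z, p.2) /
          ((z.1 i - p.1.1 i) * (conj (z.1 j) - conj (p.2.1 j))))
      (𝓝[{p : Ω₀ × Ω₀ | (p.1.1 i ≠ z.1 i ∧ ∀ l, l ≠ i → p.1.1 l = z.1 l) ∧
          (p.2.1 j ≠ z.1 j ∧ ∀ l, l ≠ j → p.2.1 l = z.1 l)}] (z, z))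
      (𝓝 (inner ℂ
        (projTmul (RKHS.kerFun H z (1 : ℂ))
          (fderiv ℂ (kernelSection Ω₀ H) (star z.1) (Pi.single i 1)))
        (projTmul (RKHS.kerFun H z (1 : ℂ))
          (fderiv ℂ (kernelSection Ω₀ H) (star z.1) (Pi.single j 1))))) := by
  have hset : {p : Ω₀ × Ω₀ | (p.1.1 i ≠ z.1 i ∧ ∀ l, l ≠ i → p.1.1 l = z.1 l) ∧
      (p.2.1 j ≠ z.1 j ∧ ∀ l, l ≠ j → p.2.1 l = z.1 l)} =
      {ζ : Ω₀ | ζ.1 i ≠ z.1 i ∧ ∀ l, l ≠ i → ζ.1 l = z.1 l} ×ˢ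
        {ζ : Ω₀ | ζ.1 j ≠ z.1 j ∧ ∀ l, l ≠ j → ζ.1 l = z.1 l} := rfl
  rw [hset, nhdsWithin_prod_eq]
  set li := 𝓝[{ζ : Ω₀ | ζ.1 i ≠ z.1 i ∧ ∀ l, l ≠ i → ζ.1 l = z.1 l}] z
  set lj := 𝓝[{ζ : Ω₀ | ζ.1 j ≠ z.1 j ∧ ∀ l, l ≠ j → ζ.1 l = z.1 l}] z
  set P : H →L[ℂ] diagVanishing H := projTmul (RKHS.kerFun H z (1 : ℂ)) with hP
  have hi := (P.continuous.tendsto _).comp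
    ((tendsto_kernelSection_slope hΩ₀ hol z i).comp (tendsto_fst (f := li) (g := lj)))
  have hj := (P.continuous.tendsto _).comp
    ((tendsto_kernelSection_slope hΩ₀ hol z j).comp (tendsto_snd (f := li) (g := lj)))
  refine (Tendsto.inner (𝕜 := ℂ) hi hj).congr fun p => ?_
  have hPz : P (RKHS.kerFun H z (1 : ℂ)) = 0 := projTmul_kerFun_self z
  simp only [Function.comp_apply, map_smul, map_sub, hPz, sub_zero]
  refine (inner_smul_left (𝕜 := ℂ) (E := diagVanishing H) _ _ _).trans
    ((congrArg _ (inner_smul_right (𝕜 := ℂ) (E := diagVanishing H) _ _ _)).trans ?_)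
  -- The first slot conjugates its scalar, giving `ζ_i - z_i` without bars; the signs of the two
  -- factors cancel.
  simp only [map_inv₀, map_sub, Complex.conj_conj]
  rw [scalarKernel_diagVanishing, ← hP, ← neg_sub (p.1.1 i), ← neg_sub (conj (p.2.1 j)),
    neg_mul_neg, div_eq_mul_inv, mul_inv]
  ring

end KernelFrame

/-! ### Kernel functions as joint eigenvectors -/

section KernelBundle

variable {m : ℕ} {E : Type*} [NormedAddCommGroup E] [InnerProductSpace ℂ E]
  {Ω Ω₀ : Set (Fin m → ℂ)} {H : Type*}
  [NormedAddCommGroup H] [InnerProductSpace ℂ H] [CompleteSpace H] [RKHS ℂ H Ω₀ ℂ]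

theorem mem_jointKer_iff {T : Fin m → E →L[ℂ] E} {w : Fin m → ℂ} {x : E} :
    x ∈ jointKer T w ↔ ∀ i, T i x = w i • x := by
  simp [jointKer, tupleSub, funext_iff, sub_eq_zero]

theorem adjoint_apply_kerFun {M : Fin m → H →L[ℂ] H} (hM : IsCoordinateMultiplication M)
    (x : Ω₀) (i : Fin m) :
    ContinuousLinearMap.adjoint (M i) (RKHS.kerFun H x (1 : ℂ)) =
      conj (x.1 i) • RKHS.kerFun H x (1 : ℂ) := by
  refine ext_inner_right ℂ fun f => ?_
  rw [ContinuousLinearMap.adjoint_inner_left, inner_smul_left, RKHS.kerFun_inner,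
    RKHS.kerFun_inner, hM i f x]
  simp

theorem symm_kerFun_mem_jointKer {T : Fin m → E →L[ℂ] E} {M : Fin m → H →L[ℂ] H}
    (hM : IsCoordinateMultiplication M) (V : E ≃ₗᵢ[ℂ] H)
    (hV : ∀ i x, V (T i x) = ContinuousLinearMap.adjoint (M i) (V x)) (x : Ω₀) :
    V.symm (RKHS.kerFun H x (1 : ℂ)) ∈ jointKer T (star x.1) := by
  rw [mem_jointKer_iff]
  intro i
  refine V.injective ?_
  rw [hV, map_smul, V.apply_symm_apply, adjoint_apply_kerFun hM]
  rfl

theorem span_singleton_eq_of_rank_one {W : Submodule ℂ E} (hW : Module.rank ℂ W = 1) {x : E}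
    (hx : x ∈ W) (hx0 : x ≠ 0) : Submodule.span ℂ {x} = W := by
  refine le_antisymm ((Submodule.span_singleton_le_iff_mem _ _).mpr hx) fun y hy => ?_
  have hf : Module.finrank ℂ W = 1 := Module.rank_eq_one_iff_finrank_eq_one.mp hW
  obtain ⟨c, hc⟩ := exists_smul_eq_of_finrank_eq_one hf
    (x := (⟨x, hx⟩ : W)) (by simpa using hx0) ⟨y, hy⟩
  exact Submodule.mem_span_singleton.mpr ⟨c, congrArg Subtype.val hc⟩

/-- The kernel functions are a holomorphic frame where they do not vanish. -/
theorem isHolomorphicFrame_kernelSection {T : Fin m → E →L[ℂ] E}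
    (hT : IsCowenDouglas 1 (conjSet Ω) T) (hΩ₀o : IsOpen Ω₀) (hΩ₀ : Ω₀ ⊆ Ω)
    (hol : ConsistsOfHolomorphic Ω₀ H) {M : Fin m → H →L[ℂ] H}
    (hM : IsCoordinateMultiplication M) (V : E ≃ₗᵢ[ℂ] H)
    (hV : ∀ i x, V (T i x) = ContinuousLinearMap.adjoint (M i) (V x)) :
    IsHolomorphicFrame T (conjSet Ω₀ ∩ kernelSection Ω₀ H ⁻¹' {0}ᶜ)
      (fun u => V.symm (kernelSection Ω₀ H u)) where
  isOpen := (differentiableOn_kernelSection hΩ₀o hol).continuousOn.isOpen_inter_preimage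
    (isOpen_conjSet hΩ₀o) isOpen_compl_singleton
  differentiableOn := V.symm.toContinuousLinearEquiv.differentiable.comp_differentiableOn
    ((differentiableOn_kernelSection hΩ₀o hol).mono Set.inter_subset_left)
  ne_zero u hu := by simpa using hu.2
  span_eq u hu := by
    refine span_singleton_eq_of_rank_one ?_ ?_ (by simpa using hu.2)
    · simpa using hT.rank_ker u (hΩ₀ hu.1)
    · have := symm_kerFun_mem_jointKer hM V hV (⟨star u, hu.1⟩ : Ω₀)
      rw [kernelSection_of_mem (Ω₀ := Ω₀) hu.1]
      simpa using this

end KernelBundle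

end CowenDouglasCurvature

end

/-! ### Comparison of the curvature with the limit -/

theorem mainTheorem8 {m : ℕ}
    (Ω : Set (Fin m → ℂ)) (hΩo : IsOpen Ω) (hΩc : IsConnected Ω) (hΩb : Bornology.IsBounded Ω)
    {E : Type*} [NormedAddCommGroup E] [InnerProductSpace ℂ E] [CompleteSpace E]
    [TopologicalSpace.SeparableSpace E]
    (T : Fin m → E →L[ℂ] E) (hT : IsCowenDouglas 1 (conjSet Ω) T)
    (Ω₀ : Set (Fin m → ℂ)) (hΩ₀o : IsOpen Ω₀) (hΩ₀ : Ω₀ ⊆ Ω)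
    {H : Type*} [NormedAddCommGroup H] [InnerProductSpace ℂ H] [CompleteSpace H]
    [RKHS ℂ H Ω₀ ℂ] (hol : ConsistsOfHolomorphic Ω₀ H)
    (M : Fin m → H →L[ℂ] H) (hM : IsCoordinateMultiplication M)
    (V : E ≃ₗᵢ[ℂ] H) (hV : ∀ i x, V (T i x) = ContinuousLinearMap.adjoint (M i) (V x))
    (z : Ω₀) (hz : scalarKernel H z z ≠ 0) :
    ∃ 𝒦 : Matrix (Fin m) (Fin m) ℂ, IsCurvatureAt Ω T z 𝒦 ∧
      (∀ i j : Fin m, ∃ L : ℂ,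
        Tendsto
          (fun p : Ω₀ × Ω₀ =>
            scalarKernel (diagVanishing H) (z, p.1) (z, p.2) /
              ((z.1 i - p.1.1 i) * (conj (z.1 j) - conj (p.2.1 j))))
          (𝓝[{p : Ω₀ × Ω₀ | (p.1.1 i ≠ z.1 i ∧ ∀ l, l ≠ i → p.1.1 l = z.1 l) ∧
              (p.2.1 j ≠ z.1 j ∧ ∀ l, l ≠ j → p.2.1 l = z.1 l)}] (z, z))
          (𝓝 L) ∧
        𝒦 i j = -(2 / scalarKernel H z z ^ 2) * L) ∧
      (∀ i : Fin m, ∃ L : ℂ,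
        Tendsto
          (fun ζ : Ω₀ =>
            scalarKernel (diagVanishing H) (z, ζ) (z, ζ) /
              ((z.1 i - ζ.1 i) * (conj (z.1 i) - conj (ζ.1 i))))
          (𝓝[{ζ : Ω₀ | ζ.1 i ≠ z.1 i ∧ ∀ l, l ≠ i → ζ.1 l = z.1 l}] z)
          (𝓝 L) ∧
        𝒦 i i = -(2 / scalarKernel H z z ^ 2) * L) := by
  have hframe := isHolomorphicFrame_kernelSection hT hΩ₀o hΩ₀ hol hM V hV
  have hzmem : star (star z.1) ∈ Ω₀ := by simp
  have hz0 : RKHS.kerFun H z (1 : ℂ) ≠ 0 := fun h => hz (by rw [scalarKernel_eq_inner, h]; simp)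
  have hzU : star z.1 ∈ conjSet Ω₀ ∩ kernelSection Ω₀ H ⁻¹' {0}ᶜ :=
    ⟨hzmem, by simpa [kernelSection_star] using hz0⟩
  have hdiff : DifferentiableAt ℂ (kernelSection Ω₀ H) (star z.1) :=
    (differentiableOn_kernelSection hΩ₀o hol).differentiableAt
      ((isOpen_conjSet hΩ₀o).mem_nhds hzmem)
  have hder : ∀ v, fderiv ℂ (fun u => V.symm (kernelSection Ω₀ H u)) (star z.1) v =
      V.symm (fderiv ℂ (kernelSection Ω₀ H) (star z.1) v) := fun v => by
    have h := (V.symm.toContinuousLinearEquiv.toContinuousLinearMap.hasFDerivAt).comp (star z.1)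
      hdiff.hasFDerivAt
    exact congrArg (fun L => L v) h.fderiv
  have hcurv : ∀ i j, frameCurvature (fun u => V.symm (kernelSection Ω₀ H u)) z.1 i j =
      -(2 / scalarKernel H z z ^ 2) * inner ℂ
        (projTmul (RKHS.kerFun H z (1 : ℂ))
          (fderiv ℂ (kernelSection Ω₀ H) (star z.1) (Pi.single i 1)))
        (projTmul (RKHS.kerFun H z (1 : ℂ))
          (fderiv ℂ (kernelSection Ω₀ H) (star z.1) (Pi.single j 1))) := fun i j => by
    -- Orthogonality of the symmetrizations identifies the projected inner product with half the
    -- Gram determinant in the curvature formula.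
    have horth := fun v => tmulL_add_tmulL_fderiv_mem_orthogonal hΩ₀o hol hzmem v
    simp only [kernelSection_star] at horth
    rw [frameCurvature_apply hframe.isOpen hframe.differentiableOn hframe.ne_zero hzU,
      inner_projTmul_of_mem_orthogonal (horth _) (horth _), hder, hder, kernelSection_star]
    simp only [LinearIsometryEquiv.inner_map_map]
    rw [scalarKernel_eq_inner] at hz ⊢
    field_simp
  have hlim := tendsto_scalarKernel_diagVanishing hΩ₀o hol z
  refine ⟨frameCurvature (fun u => V.symm (kernelSection Ω₀ H u)) z.1,
    ⟨⟨_, _, fun u hu => hΩ₀ hu.1, hzU, hframe⟩, fun U γ _ hU hγ =>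
      frameCurvature_eq_of_isHolomorphicFrame hframe hγ hzU hU⟩,
    fun i j => ⟨_, hlim i j, hcurv i j⟩, fun i => ⟨_, ?_, hcurv i i⟩⟩
  -- The one-variable limit is the double limit restricted to the diagonal `ν = ζ`.
  refine (hlim i i).comp (f := fun ζ : Ω₀ => (ζ, ζ)) (tendsto_nhdsWithin_iff.mpr ⟨?_, ?_⟩)
  · have : Continuous fun ζ : Ω₀ => (ζ, ζ) := by fun_prop
    exact (this.tendsto z).mono_left nhdsWithin_le_nhds
  · filter_upwards [self_mem_nhdsWithin] with ζ hζ
    exact ⟨hζ, hζ⟩
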